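/- Let $(\Omega,\mathcal F,P)$ be a probability space and let $p,q\in[1,\infty]$ satisfy $\frac1p+\frac1q=1$. For a random variable $L$ with distribution function $F_L(x)=P(L\le x)$ let $F_L^{-1}(u)=\inf\{x: F_L(x)\ge u\}$ be its quantile function. Let $\sigma\in L^q([0,1])$ be a distortion, i.e. a nonnegative, nondecreasing function with $\int_0^1\sigma(u)\,du=1$ (finite on $[0,1)$, possibly unbounded near $1$), and let $$\pi_\sigma(L)=\int_0^1F_L^{-1}(u)\,\sigma(u)\,du\qquad(L\in L^p)$$ be the distorted premium functional. For a random variable $Z$ let $\mathrm{CTE}_\alpha(Z)=\frac1{1-\alpha}\int_\alpha^1F_Z^{-1}(u)\,du$ for $0\le\alpha<1$ and $\mathrm{CTE}_1(Z)=\operatorname{ess\,sup}Z$. For an integrable random variable $Z$ on $\Omega$ write $Z\preccurlyeq\sigma$ if $$\mathbb E Z=\int_0^1\sigma(u)\,du\quad\text{and}\quad(1-\alpha)\,\mathrm{CTE}_\alpha(Z)\le\int_\alpha^1\sigma(u)\,du\ \text{ for all }\alpha\in[0,1],$$ where $0\cdot\infty=0$. Then every $Z\preccurlyeq\sigma$ belongs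 to $L^q$, and for every $L\in L^p$ the integral defining $\pi_\sigma(L)$ converges absolutely and $$\pi_\sigma(L)=\sup\{\mathbb E[LZ]: Z\preccurlyeq\sigma\}=\sup\Big\{\mathbb E[LZ]: Z \text{ integrable},\ \mathbb E Z=1,\ (1-\alpha)\,\mathrm{CTE}_\alpha(Z)\le\int_\alpha^1\sigma(u)\,du\text{ for all }0\le\alpha<1\Big\}.$$ Moreover, the convex conjugate $\pi_\sigma^*(Z)=\sup_{L\in L^p}\big(\mathbb E[LZ]-\pi_\sigma(L)\big)$ satisfies, for every $Z\in L^q$, $$\pi_\sigma^*(Z)=\begin{cases}0&\text{if }Z\preccurlyeq\sigma,\\+\infty&\text{otherwise.}\end{cases}$$ -/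

import Mathlib

open MeasureTheory Set

open scoped ENNReal

namespace DistortedPremium

/-- A distortion: a nonnegative, nondecreasing density on the unit interval. Finiteness and
monotonicity are asked for on `[0, 1)` only, so that `σ` may be unbounded near `1`; the value at
the endpoint `1` enters no integral. -/
structure IsDistortion (σ : ℝ → ℝ) : Prop where
  nonneg : ∀ u ∈ Ico (0 : ℝ) 1, 0 ≤ σ u
  mono : MonotoneOn σ (Ico (0 : ℝ) 1)
  integral_eq_one : ∫ u in (0 : ℝ)..1, σ u = 1

variable {Ω : Type*} [MeasurableSpace Ω]

/-- The generalized inverse `F_L⁻¹(u) = inf {x : F_L(x) ≥ u}` of the cumulative distribution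
function `F_L` of the random variable `L`. -/
noncomputable def quantile (μ : Measure Ω) (L : Ω → ℝ) (u : ℝ) : ℝ :=
  sInf {x : ℝ | u ≤ ProbabilityTheory.cdf (μ.map L) x}

/-- The distorted premium `π_σ(L) = ∫₀¹ F_L⁻¹(u) σ(u) du`. -/
noncomputable def premium (μ : Measure Ω) (σ : ℝ → ℝ) (L : Ω → ℝ) : ℝ :=
  ∫ u in (0 : ℝ)..1, quantile μ L u * σ u

open Classical in
/-- The conditional tail expectation at level `α`: it is `(1 - α)⁻¹ ∫_α^1 F_Z⁻¹(p) dp` for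
`α < 1`, and the essential supremum, possibly infinite, for `α = 1`. -/
noncomputable def CTE (μ : Measure Ω) (α : ℝ) (Z : Ω → ℝ) : EReal :=
  if α < 1 then (((1 - α)⁻¹ * ∫ p in α..1, quantile μ Z p : ℝ) : EReal)
  else essSup (fun ω => (Z ω : EReal)) μ

/-- `Z ≼ σ`: the function `σ` majorizes the integrable random variable `Z`.
At `α = 1` both sides of the inequality are zero (`0 * ⊤ = 0` in `EReal`). -/
structure Majorized (μ : Measure Ω) (Z : Ω → ℝ) (σ : ℝ → ℝ) : Prop where
  integrable : Integrable Z μ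
  le : ∀ α ∈ Icc (0 : ℝ) 1,
    ((1 - α : ℝ) : EReal) * CTE μ α Z ≤ ((∫ p in α..1, σ p : ℝ) : EReal)
  integral_eq : ∫ ω, Z ω ∂μ = ∫ p in (0 : ℝ)..1, σ p

/-- The convex conjugate `π_σ^*(Z) = sup_L (E[L Z] - π_σ(L))`, the supremum being over all
`L ∈ L^p`. -/
noncomputable def conjugate (μ : Measure Ω) (p : ℝ≥0∞) (σ : ℝ → ℝ) (Z : Ω → ℝ) : EReal :=
  ⨆ (L : Ω → ℝ) (_ : MemLp L p μ), ((∫ ω, L ω * Z ω ∂μ - premium μ σ L : ℝ) : EReal)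

open Classical in
/-- The indicator function of convex analysis: `0` on the set `A` and `+∞` off it. -/
noncomputable def convexIndicator {E : Type*} (A : Set E) (z : E) : EReal :=
  if z ∈ A then 0 else ⊤

end DistortedPremium

/-!
Write `U` for Lebesgue measure on the unit interval and `q_L` for the quantile function of `L`.

Everything rests on one description of tail integrals: for every `c`, the integral of `f` over
`(a, 1)` is at most `∫ (f - c)⁺ dU + c (1 - a)`, with equality if `f` is nondecreasing and
`c = f a` (`tail_integral_le`, `tail_integral_eq`). Since `q_Z` has under `U` the law of `Z`
(`identDistrib_quantile`), it follows that `Z ≼ σ` as soon as `E Z = 1` and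
`E (Z - c)⁺ ≤ ∫ (σ - c)⁺ dU` for all `c` (`majorized_of_integral_excess_le`), and that `Z ≼ σ`
implies `E[Z; A] ≤ ∫_{1 - P(A)}^1 σ` for every event `A` (`Majorized.setIntegral_le`).

*Upper bound.* Let `Z ≼ σ`. Taking `A = {Z ≥ 0}` shows `Z ≥ 0`, so `Z dP` and `σ dU` are probability
measures. Taking `A = {L > t}`, whose counterpart `{q_L > t}` is an upper tail of the unit
interval, shows that `L` under the former is stochastically dominated by `q_L` under the latter;
hence `E[L Z] ≤ π_σ(L)` (`Majorized.integral_mul_le_premium`). Applied to powers of truncations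
of `Z`, this inequality and Young's inequality give `Z ∈ L^q` (`Majorized.memLp`).

*Attainment.* The image of `σ dU` under `q_L` is absolutely continuous with respect to the law of
`L`. If `h` is its density, then `E[g(L) h(L)] = ∫ g(q_L) σ dU` for every bounded `g` and for the
identity. The choice of the identity gives `E[L h(L)] = π_σ(L)`, and indicators give the
excess inequalities, so `h(L) ≼ σ` (`exists_majorized_integral_mul_eq_premium`). No assumption
that the probability space is atomless is needed.

*Conjugate.* If `E Z ≠ 1`, a constant has `E[L Z] > π_σ(L)`; if an excess inequality fails at `c`,
the indicator of `{Z > c}` does (`exists_premium_lt_of_not_majorized`). Positive homogeneity of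
the premium then drives the conjugate to infinity, while it is `0` on the majorized variables.
-/

namespace DistortedPremium

open ProbabilityTheory Filter Topology

/-! ### Lebesgue measure on the unit interval -/

/-- Lebesgue measure on the open unit interval. The endpoints are left out because the quantile
function and the distortion carry no information there. -/
noncomputable abbrev unitVol : Measure ℝ := volume.restrict (Ioo (0 : ℝ) 1)

instance : IsProbabilityMeasure unitVol := ⟨by simp⟩

lemma ae_mem_unitInterval : ∀ᵐ u ∂unitVol, u ∈ Ioo (0 : ℝ) 1 :=
  ae_restrict_mem measurableSet_Ioo

lemma restrict_Icc_eq_unitVol : (volume : Measure ℝ).restrict (Icc 0 1) = unitVol :=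
  (restrict_Ioo_eq_restrict_Icc).symm

lemma unitVol_Iic {a : ℝ} (h1 : a ≤ 1) : unitVol (Iic a) = ENNReal.ofReal a := by
  have h : unitVol = (volume : Measure ℝ).restrict (Ioc 0 1) := restrict_Ioo_eq_restrict_Ioc
  have h' : Iic a ∩ Ioc (0 : ℝ) 1 = Ioc 0 a := by
    ext x
    simp only [mem_inter_iff, mem_Iic, mem_Ioc]
    constructor
    · rintro ⟨h, h', -⟩
      exact ⟨h', h⟩
    · rintro ⟨h, h'⟩
      exact ⟨h', h, h'.trans h1⟩
  rw [h, Measure.restrict_apply measurableSet_Iic, h', Real.volume_Ioc, sub_zero]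

lemma unitVol_real_Ioi {a : ℝ} (h0 : 0 ≤ a) (h1 : a ≤ 1) : unitVol.real (Ioi a) = 1 - a := by
  have h := probReal_compl_eq_one_sub (μ := unitVol) (measurableSet_Iic (a := a))
  rw [compl_Iic] at h
  rw [h, measureReal_def, unitVol_Iic h1, ENNReal.toReal_ofReal h0]

lemma intervalIntegral_eq_unitVol {a : ℝ} (h0 : 0 ≤ a) (h1 : a ≤ 1) (f : ℝ → ℝ) :
    ∫ u in a..1, f u = ∫ u in Ioi a, f u ∂unitVol := by
  have h : Ioi a ∩ Ioo (0 : ℝ) 1 = Ioo a 1 := by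
    ext x
    simp only [mem_inter_iff, mem_Ioi, mem_Ioo]
    constructor
    · rintro ⟨h, -, h'⟩
      exact ⟨h, h'⟩
    · rintro ⟨h, h'⟩
      exact ⟨h, h0.trans_lt h, h'⟩
  rw [Measure.restrict_restrict measurableSet_Ioi, h, intervalIntegral.integral_of_le h1,
    integral_Ioc_eq_integral_Ioo]

lemma intervalIntegral_zero_one (f : ℝ → ℝ) : ∫ u in (0 : ℝ)..1, f u = ∫ u, f u ∂unitVol := by
  rw [intervalIntegral.integral_of_le zero_le_one, integral_Ioc_eq_integral_Ioo]

/-- Every constant `c` bounds a tail integral by the corresponding integrated excess over `c`. -/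
lemma tail_integral_le {f : ℝ → ℝ} (hf : Integrable f unitVol) {a : ℝ} (h0 : 0 ≤ a) (h1 : a ≤ 1)
    (c : ℝ) :
    ∫ u in a..1, f u ≤ ∫ u, max (f u - c) 0 ∂unitVol + c * (1 - a) := by
  have hm : Integrable (fun u => max (f u - c) 0) unitVol := (hf.sub (integrable_const c)).pos_part
  rw [intervalIntegral_eq_unitVol h0 h1]
  calc ∫ u in Ioi a, f u ∂unitVol
      ≤ ∫ u in Ioi a, (max (f u - c) 0 + c) ∂unitVol := by
        refine integral_mono hf.integrableOn (hm.add (integrable_const c)).integrableOn fun u => ?_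
        have := le_max_left (f u - c) 0
        simp only
        linarith
    _ = ∫ u in Ioi a, max (f u - c) 0 ∂unitVol + c * (1 - a) := by
        rw [integral_add hm.integrableOn (integrable_const c), setIntegral_const,
          unitVol_real_Ioi h0 h1, smul_eq_mul, mul_comm]
    _ ≤ _ := by
        exact add_le_add
          (setIntegral_le_integral hm (ae_of_all _ fun _ => le_max_right _ _)) le_rfl

/-- For a nondecreasing function the bound of `tail_integral_le` is attained at the value of the
function at the lower limit of integration. -/
lemma tail_integral_eq {f : ℝ → ℝ} (hf : Integrable f unitVol) (hmono : MonotoneOn f (Ioo 0 1))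
    {a : ℝ} (ha : a ∈ Ioo (0 : ℝ) 1) :
    ∫ u in a..1, f u = ∫ u, max (f u - f a) 0 ∂unitVol + f a * (1 - a) := by
  have hm : Integrable (fun u => max (f u - f a) 0) unitVol :=
    (hf.sub (integrable_const _)).pos_part
  have h : ∫ u, max (f u - f a) 0 ∂unitVol = ∫ u in Ioi a, (f u - f a) ∂unitVol := by
    rw [← integral_indicator measurableSet_Ioi]
    refine integral_congr_ae ?_
    filter_upwards [ae_mem_unitInterval] with u hu
    by_cases h : a < u
    · simpa [indicator, h] using hmono ha hu h.le
    · simpa [indicator, h] using hmono hu ha (not_lt.1 h)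
  rw [intervalIntegral_eq_unitVol ha.1.le ha.2.le, h,
    integral_sub hf.integrableOn (integrable_const _), setIntegral_const,
    unitVol_real_Ioi ha.1.le ha.2.le, smul_eq_mul]
  ring

/-! ### The quantile function -/

variable {Ω : Type*} [MeasurableSpace Ω] {μ : Measure Ω} {L Z : Ω → ℝ} {σ : ℝ → ℝ}

/-- The Galois connection between the quantile function and the distribution function. -/
lemma quantile_le_iff {u : ℝ} (hu : u ∈ Ioo (0 : ℝ) 1) (x : ℝ) :
    quantile μ L u ≤ x ↔ u ≤ cdf (μ.map L) x := by
  set F := cdf (μ.map L)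
  have hne : {x | u ≤ F x}.Nonempty :=
    ((tendsto_cdf_atTop (μ.map L)).eventually_const_le hu.2).exists
  have hbdd : BddBelow {x | u ≤ F x} := by
    obtain ⟨b, hb⟩ := ((tendsto_cdf_atBot (μ.map L)).eventually_lt_const hu.1).exists
    refine ⟨b, fun y hy => ?_⟩
    by_contra! h
    exact absurd (hy.trans (F.mono h.le)) (not_le.2 hb)
  refine ⟨fun h => ?_, fun h => csInf_le hbdd h⟩
  -- right continuity of the distribution function makes the infimum a minimum
  have hr : Tendsto F (𝓝[>] x) (𝓝 (F x)) :=
    (F.right_continuous x).tendsto.mono_left (nhdsWithin_mono _ Ioi_subset_Ici_self)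
  refine ge_of_tendsto hr ?_
  filter_upwards [self_mem_nhdsWithin] with y hy
  obtain ⟨z, hz, hzy⟩ := exists_lt_of_csInf_lt hne (h.trans_lt hy)
  exact le_trans hz (F.mono hzy.le)

lemma quantile_monotoneOn : MonotoneOn (quantile μ L) (Ioo 0 1) := fun _ hu _ hv huv =>
  (quantile_le_iff hu _).2 (huv.trans ((quantile_le_iff hv _).1 le_rfl))

lemma quantile_aemeasurable : AEMeasurable (quantile μ L) unitVol :=
  aemeasurable_restrict_of_monotoneOn measurableSet_Ioo quantile_monotoneOn

/-- Under Lebesgue measure on the unit interval, the quantile function of `L` has the law of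
`L`. -/
lemma identDistrib_quantile [IsProbabilityMeasure μ] (hL : AEMeasurable L μ) :
    IdentDistrib (quantile μ L) L unitVol μ := by
  refine ⟨quantile_aemeasurable, hL, ?_⟩
  have := Measure.isProbabilityMeasure_map hL
  have := Measure.isProbabilityMeasure_map (quantile_aemeasurable (μ := μ) (L := L))
  refine Measure.ext_of_Iic _ _ fun x => ?_
  rw [Measure.map_apply_of_aemeasurable quantile_aemeasurable measurableSet_Iic, ← ofReal_cdf,
    ← unitVol_Iic (cdf_le_one _ _)]
  refine measure_congr ?_
  filter_upwards [ae_mem_unitInterval] with u hu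
  exact propext (quantile_le_iff hu x)

/-- Among all events of a given probability, the integral of `Z` is largest on the upper tail. -/
lemma setIntegral_le_tail_quantile [IsProbabilityMeasure μ] (hZ : Integrable Z μ) (A : Set Ω) :
    ∫ ω in A, Z ω ∂μ ≤ ∫ u in (1 - μ.real A)..1, quantile μ Z u := by
  have hid := identDistrib_quantile hZ.aemeasurable
  have hq : Integrable (quantile μ Z) unitVol := hid.integrable_iff.2 hZ
  have h0 : 0 ≤ μ.real A := measureReal_nonneg
  have h1 : μ.real A ≤ 1 := measureReal_le_one
  rcases h0.eq_or_lt with h | h0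
  · rw [← h, sub_zero, intervalIntegral.integral_same,
      setIntegral_measure_zero _ ((measureReal_eq_zero_iff).1 h.symm)]
  rcases h1.eq_or_lt with h | h1
  · have hA : μ.restrict A = μ := by
      rw [← Measure.restrict_toMeasurable (measure_ne_top μ A)]
      refine Measure.restrict_eq_self_of_ae_mem ?_
      refine (mem_ae_iff_prob_eq_one (measurableSet_toMeasurable μ A)).2 ?_
      rw [measure_toMeasurable, ← ofReal_measureReal, h, ENNReal.ofReal_one]
    rw [h, sub_self, intervalIntegral_zero_one, hid.integral_eq, hA]
  · set c := quantile μ Z (1 - μ.real A)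
    have hm : Integrable (fun ω => max (Z ω - c) 0) μ := (hZ.sub (integrable_const c)).pos_part
    have hc : ∫ u, max (quantile μ Z u - c) 0 ∂unitVol = ∫ ω, max (Z ω - c) 0 ∂μ :=
      (hid.comp (u := fun x => max (x - c) 0) (by fun_prop)).integral_eq
    rw [tail_integral_eq hq quantile_monotoneOn ⟨by linarith, by linarith⟩, hc]
    calc ∫ ω in A, Z ω ∂μ ≤ ∫ ω in A, (max (Z ω - c) 0 + c) ∂μ := by
          refine integral_mono hZ.integrableOn (hm.add (integrable_const c)).integrableOn
            fun ω => ?_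
          have := le_max_left (Z ω - c) 0
          simp only
          linarith
      _ = ∫ ω in A, max (Z ω - c) 0 ∂μ + c * (1 - (1 - μ.real A)) := by
          rw [integral_add hm.integrableOn (integrable_const c), setIntegral_const,
            sub_sub_cancel, smul_eq_mul, mul_comm]
      _ ≤ _ := by
          exact add_le_add
            (setIntegral_le_integral hm (ae_of_all _ fun _ => le_max_right _ _)) le_rfl

/-! ### Majorization by a distortion -/

lemma IsDistortion.integral_unitVol (hσ : IsDistortion σ) : ∫ u, σ u ∂unitVol = 1 := by
  rw [← intervalIntegral_zero_one, hσ.integral_eq_one]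

/-- A distortion is integrable because the Bochner integral of a nonintegrable function is `0`. -/
lemma IsDistortion.integrable (hσ : IsDistortion σ) : Integrable σ unitVol := by
  by_contra h
  exact one_ne_zero (hσ.integral_unitVol.symm.trans (integral_undef h))

lemma IsDistortion.ae_nonneg (hσ : IsDistortion σ) : 0 ≤ᵐ[unitVol] σ := by
  filter_upwards [ae_mem_unitInterval] with u hu using hσ.nonneg u ⟨hu.1.le, hu.2⟩

lemma IsDistortion.monotoneOn (hσ : IsDistortion σ) : MonotoneOn σ (Ioo 0 1) :=
  hσ.mono.mono Ioo_subset_Ico_self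

lemma mul_CTE_le_iff {a : ℝ} (ha : a < 1) (x : ℝ) :
    ((1 - a : ℝ) : EReal) * CTE μ a Z ≤ (x : EReal) ↔ ∫ u in a..1, quantile μ Z u ≤ x := by
  have h : 1 - a ≠ 0 := by linarith
  rw [CTE, if_pos ha, ← EReal.coe_mul, EReal.coe_le_coe_iff, mul_inv_cancel_left₀ h]

/-- Majorization in terms of tail integrals of the quantile function; the condition at level `1`
is void. -/
lemma majorized_iff : Majorized μ Z σ ↔ Integrable Z μ ∧ ∫ ω, Z ω ∂μ = ∫ u in (0 : ℝ)..1, σ u ∧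
    ∀ a : ℝ, 0 ≤ a → a < 1 → ∫ u in a..1, quantile μ Z u ≤ ∫ u in a..1, σ u := by
  refine ⟨fun h => ⟨h.integrable, h.integral_eq, fun a h0 h1 =>
    (mul_CTE_le_iff h1 _).1 (h.le a ⟨h0, h1.le⟩)⟩, fun h => ⟨h.1, fun a ha => ?_, h.2.1⟩⟩
  rcases ha.2.eq_or_lt with rfl | h1
  · simp
  · exact (mul_CTE_le_iff h1 _).2 (h.2.2 a ha.1 h1)

/-- Domination in the increasing convex order, with equal means, implies majorization. -/
lemma majorized_of_integral_excess_le [IsProbabilityMeasure μ] (hσ : IsDistortion σ)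
    (hZ : Integrable Z μ) (hZ1 : ∫ ω, Z ω ∂μ = 1)
    (h : ∀ c : ℝ, ∫ ω, max (Z ω - c) 0 ∂μ ≤ ∫ u, max (σ u - c) 0 ∂unitVol) :
    Majorized μ Z σ := by
  have hid := identDistrib_quantile hZ.aemeasurable
  refine majorized_iff.2 ⟨hZ, hZ1.trans hσ.integral_eq_one.symm, fun a h0 h1 => ?_⟩
  rcases h0.eq_or_lt with rfl | h0
  · rw [intervalIntegral_zero_one, hid.integral_eq, hZ1, hσ.integral_eq_one]
  · rw [tail_integral_eq hσ.integrable hσ.monotoneOn ⟨h0, h1⟩]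
    refine (tail_integral_le (hid.integrable_iff.2 hZ) h0.le h1.le (σ a)).trans ?_
    have := (hid.comp (u := fun x => max (x - σ a) 0) (by fun_prop)).integral_eq
    exact add_le_add (this.trans_le (h _)) le_rfl

lemma Majorized.setIntegral_le [IsProbabilityMeasure μ] (h : Majorized μ Z σ) (A : Set Ω) :
    ∫ ω in A, Z ω ∂μ ≤ ∫ u in (1 - μ.real A)..1, σ u := by
  have h0 : 0 ≤ μ.real A := measureReal_nonneg
  have h1 : μ.real A ≤ 1 := measureReal_le_one
  rcases h0.eq_or_lt with hA | h0
  · rw [← hA, sub_zero, intervalIntegral.integral_same,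
      setIntegral_measure_zero _ ((measureReal_eq_zero_iff).1 hA.symm)]
  · exact (setIntegral_le_tail_quantile h.integrable A).trans
      ((majorized_iff.1 h).2.2 _ (by linarith) (by linarith))

/-- A majorized variable is nonnegative: its integral over the event where it is nonnegative
leaves at least a lower tail integral of `σ` for the complementary event. -/
lemma Majorized.ae_nonneg [IsProbabilityMeasure μ] (hσ : IsDistortion σ) (h : Majorized μ Z σ) :
    0 ≤ᵐ[μ] Z := by
  have hn : Integrable (fun ω => max (Z ω) 0) μ := h.integrable.pos_part
  set A := {ω | 0 ≤ Z ω}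
  have hA : NullMeasurableSet A μ :=
    nullMeasurableSet_le aemeasurable_const h.integrable.aemeasurable
  have hle : ∫ ω, max (Z ω) 0 ∂μ ≤ 1 := by
    have h1 : ∫ ω, max (Z ω) 0 ∂μ = ∫ ω in A, Z ω ∂μ := by
      rw [← integral_indicator₀ hA]
      refine integral_congr_ae (ae_of_all _ fun ω => ?_)
      by_cases hω : 0 ≤ Z ω
      · simp [indicator, A, hω]
      · simp [indicator, A, hω, (not_le.1 hω).le]
    rw [h1]
    refine (h.setIntegral_le A).trans ?_
    rw [intervalIntegral_eq_unitVol (by linarith [measureReal_le_one (μ := μ) (s := A)])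
      (by linarith [measureReal_nonneg (μ := μ) (s := A)]), ← hσ.integral_unitVol]
    exact setIntegral_le_integral hσ.integrable hσ.ae_nonneg
  have hZ1 : ∫ ω, Z ω ∂μ = 1 := h.integral_eq.trans hσ.integral_eq_one
  have hd : ∫ ω, (max (Z ω) 0 - Z ω) ∂μ = 0 := by
    have hnn : 0 ≤ ∫ ω, (max (Z ω) 0 - Z ω) ∂μ :=
      integral_nonneg fun ω => sub_nonneg.2 (le_max_left _ _)
    rw [integral_sub hn h.integrable] at hnn ⊢
    linarith
  rw [integral_eq_zero_iff_of_nonneg (fun ω => sub_nonneg.2 (le_max_left _ _))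
    (hn.sub h.integrable)] at hd
  filter_upwards [hd] with ω hω
  have : max (Z ω) 0 = Z ω := sub_eq_zero.1 hω
  exact this ▸ le_max_right _ _

/-! ### The premium dominates every expectation -/

/-- First-order stochastic dominance orders expectations. -/
lemma integral_le_of_tail_le {α β : Type*} [MeasurableSpace α] [MeasurableSpace β]
    {ν : Measure α} {ρ : Measure β} [IsProbabilityMeasure ν] [IsProbabilityMeasure ρ]
    {X : α → ℝ} {Y : β → ℝ} (hX : Integrable X ν) (hY : Integrable Y ρ)
    (h : ∀ t : ℝ, ν {a | t < X a} ≤ ρ {b | t < Y b}) : ∫ a, X a ∂ν ≤ ∫ b, Y b ∂ρ := by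
  have h' : ∀ t : ℝ, ρ {b | t ≤ -Y b} ≤ ν {a | t ≤ -X a} := by
    intro t
    have hXm : NullMeasurableSet {a | -t < X a} ν :=
      nullMeasurableSet_lt aemeasurable_const hX.aemeasurable
    have hYm : NullMeasurableSet {b | -t < Y b} ρ :=
      nullMeasurableSet_lt aemeasurable_const hY.aemeasurable
    have e1 : {a | t ≤ -X a} = {a | -t < X a}ᶜ := by
      ext a; simp only [mem_ofPred_eq, mem_compl_iff, not_lt, le_neg]
    have e2 : {b | t ≤ -Y b} = {b | -t < Y b}ᶜ := by
      ext b; simp only [mem_ofPred_eq, mem_compl_iff, not_lt, le_neg]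
    rw [e1, e2, prob_compl_eq_one_sub₀ hXm, prob_compl_eq_one_sub₀ hYm]
    exact tsub_le_tsub_left (h _) _
  have hpos : ∫⁻ a, ENNReal.ofReal (X a) ∂ν ≤ ∫⁻ b, ENNReal.ofReal (Y b) ∂ρ := by
    have e : ∀ x : ℝ, ENNReal.ofReal x = ENNReal.ofReal (max x 0) := fun x => by simp
    simp_rw [e (X _), e (Y _)]
    rw [lintegral_eq_lintegral_meas_lt ν (f := fun a => max (X a) 0)
        (ae_of_all _ fun _ => le_max_right _ _)
        (hX.aemeasurable.max aemeasurable_const),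
      lintegral_eq_lintegral_meas_lt ρ (f := fun b => max (Y b) 0)
        (ae_of_all _ fun _ => le_max_right _ _)
        (hY.aemeasurable.max aemeasurable_const)]
    refine setLIntegral_mono' measurableSet_Ioi fun t ht => ?_
    have ht' : ¬ t < 0 := not_lt.2 (le_of_lt ht)
    simpa only [lt_max_iff, ht', or_false] using h t
  have hneg : ∫⁻ b, ENNReal.ofReal (-Y b) ∂ρ ≤ ∫⁻ a, ENNReal.ofReal (-X a) ∂ν := by
    have e : ∀ x : ℝ, ENNReal.ofReal x = ENNReal.ofReal (max x 0) := fun x => by simp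
    simp_rw [e (-X _), e (-Y _)]
    rw [lintegral_eq_lintegral_meas_le ρ (f := fun b => max (-Y b) 0)
        (ae_of_all _ fun _ => le_max_right _ _)
        (hY.aemeasurable.neg.max aemeasurable_const),
      lintegral_eq_lintegral_meas_le ν (f := fun a => max (-X a) 0)
        (ae_of_all _ fun _ => le_max_right _ _)
        (hX.aemeasurable.neg.max aemeasurable_const)]
    refine setLIntegral_mono' measurableSet_Ioi fun t ht => ?_
    have ht' : ¬ t ≤ 0 := not_le.2 ht
    simpa only [le_max_iff, ht', or_false] using h' t
  rw [integral_eq_lintegral_pos_part_sub_lintegral_neg_part hX,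
    integral_eq_lintegral_pos_part_sub_lintegral_neg_part hY]
  exact sub_le_sub
    (ENNReal.toReal_mono (hY.lintegral_lt_top).ne hpos)
    (ENNReal.toReal_mono (hX.neg.lintegral_lt_top).ne hneg)

lemma integral_withDensity_ofReal {α : Type*} [MeasurableSpace α] {ν : Measure α} {f : α → ℝ}
    (hf : Integrable f ν) (h0 : 0 ≤ᵐ[ν] f) (g : α → ℝ) :
    ∫ a, g a ∂(ν.withDensity fun a => ENNReal.ofReal (f a)) = ∫ a, g a * f a ∂ν := by
  rw [integral_withDensity_eq_integral_toReal_smul₀ hf.aemeasurable.ennreal_ofReal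
    (ae_of_all _ fun _ => ENNReal.ofReal_lt_top)]
  refine integral_congr_ae ?_
  filter_upwards [h0] with a ha
  rw [ENNReal.toReal_ofReal ha, smul_eq_mul, mul_comm]

lemma integrable_withDensity_ofReal {α : Type*} [MeasurableSpace α] {ν : Measure α} {f g : α → ℝ}
    (hf : Integrable f ν) (h0 : 0 ≤ᵐ[ν] f) :
    Integrable g (ν.withDensity fun a => ENNReal.ofReal (f a)) ↔
      Integrable (fun a => g a * f a) ν := by
  rw [integrable_withDensity_iff_integrable_smul₀' hf.aemeasurable.ennreal_ofReal
    (ae_of_all _ fun _ => ENNReal.ofReal_lt_top)]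
  refine integrable_congr ?_
  filter_upwards [h0] with a ha
  rw [ENNReal.toReal_ofReal ha, smul_eq_mul, mul_comm]

lemma withDensity_ofReal_apply {α : Type*} [MeasurableSpace α] {ν : Measure α} [SFinite ν]
    {f : α → ℝ} (hf : Integrable f ν) (h0 : 0 ≤ᵐ[ν] f) (s : Set α) :
    ν.withDensity (fun a => ENNReal.ofReal (f a)) s = ENNReal.ofReal (∫ a in s, f a ∂ν) := by
  rw [withDensity_apply' _ s, ofReal_integral_eq_lintegral_ofReal hf.integrableOn
    (ae_restrict_of_ae h0)]

lemma isProbabilityMeasure_withDensity_ofReal {α : Type*} [MeasurableSpace α] {ν : Measure α}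
    [SFinite ν] {f : α → ℝ} (hf : Integrable f ν) (h0 : 0 ≤ᵐ[ν] f) (h1 : ∫ a, f a ∂ν = 1) :
    IsProbabilityMeasure (ν.withDensity fun a => ENNReal.ofReal (f a)) :=
  ⟨by rw [withDensity_ofReal_apply hf h0, Measure.restrict_univ, h1, ENNReal.ofReal_one]⟩

/-- Under the law with density `Z`, the variable `L` is stochastically dominated by the quantile
function of `L` under the law with density `σ`, because an upper level set of the quantile
function is an upper tail of the unit interval. -/
lemma Majorized.integral_mul_le_premium [IsProbabilityMeasure μ] (hσ : IsDistortion σ)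
    (h : Majorized μ Z σ) (hL : AEMeasurable L μ) (hLZ : Integrable (fun ω => L ω * Z ω) μ)
    (hqσ : Integrable (fun u => quantile μ L u * σ u) unitVol) :
    ∫ ω, L ω * Z ω ∂μ ≤ premium μ σ L := by
  have hZ0 := h.ae_nonneg hσ
  have := isProbabilityMeasure_withDensity_ofReal h.integrable hZ0
    (h.integral_eq.trans hσ.integral_eq_one)
  have := isProbabilityMeasure_withDensity_ofReal hσ.integrable hσ.ae_nonneg hσ.integral_unitVol
  have := Measure.isProbabilityMeasure_map hL
  rw [premium, intervalIntegral_zero_one, ← integral_withDensity_ofReal h.integrable hZ0,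
    ← integral_withDensity_ofReal hσ.integrable hσ.ae_nonneg]
  refine integral_le_of_tail_le ((integrable_withDensity_ofReal h.integrable hZ0).2 hLZ)
    ((integrable_withDensity_ofReal hσ.integrable hσ.ae_nonneg).2 hqσ) fun t => ?_
  rw [withDensity_ofReal_apply h.integrable hZ0,
    withDensity_ofReal_apply hσ.integrable hσ.ae_nonneg]
  refine ENNReal.ofReal_le_ofReal ((h.setIntegral_le _).trans_eq ?_)
  have hF : 1 - μ.real {ω | t < L ω} = cdf (μ.map L) t := by
    have hm : NullMeasurableSet {ω | t < L ω} μ := nullMeasurableSet_lt aemeasurable_const hL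
    rw [← probReal_compl_eq_one_sub₀ hm, cdf_eq_real, measureReal_def, measureReal_def,
      Measure.map_apply_of_aemeasurable hL measurableSet_Iic]
    congr 2
    ext ω
    simp
  rw [hF, intervalIntegral_eq_unitVol (cdf_nonneg _ _) (cdf_le_one _ _)]
  congr 1
  refine Measure.restrict_congr_set ?_
  filter_upwards [ae_mem_unitInterval] with u hu
  refine propext ?_
  change cdf (μ.map L) t < u ↔ t < quantile μ L u
  rw [← not_le, ← not_le, quantile_le_iff hu]

/-! ### Integrability of majorized variables -/

lemma Majorized.memLp_top [IsProbabilityMeasure μ] (hσ : IsDistortion σ)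
    (hσq : MemLp σ ∞ unitVol) (h : Majorized μ Z σ) : MemLp Z ∞ μ := by
  obtain ⟨M, hM⟩ : ∃ M : ℝ, ∀ᵐ u ∂unitVol, σ u ≤ M := by
    refine ⟨(eLpNorm σ ∞ unitVol).toReal, ?_⟩
    have hfin : eLpNormEssSup σ unitVol ≠ ∞ := by
      rw [← eLpNorm_exponent_top]; exact hσq.2.ne
    filter_upwards [ae_le_eLpNormEssSup (f := σ) (μ := unitVol)] with u hu
    rw [eLpNorm_exponent_top]
    have := ENNReal.toReal_mono hfin hu
    rw [toReal_enorm] at this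
    exact (le_abs_self _).trans this
  set A := {ω | M < Z ω}
  have hA : NullMeasurableSet A μ :=
    nullMeasurableSet_lt aemeasurable_const h.integrable.aemeasurable
  have h0 : 0 ≤ μ.real A := measureReal_nonneg
  have h1 : μ.real A ≤ 1 := measureReal_le_one
  -- the mean of `Z` over the event `Z > M` is at most `M`, so that event is null
  have hle : ∫ ω in A, Z ω ∂μ ≤ M * μ.real A := by
    refine (h.setIntegral_le A).trans ?_
    rw [intervalIntegral_eq_unitVol (by linarith) (by linarith)]
    calc ∫ u in Ioi (1 - μ.real A), σ u ∂unitVol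
        ≤ ∫ _ in Ioi (1 - μ.real A), M ∂unitVol :=
          setIntegral_mono_ae hσ.integrable.integrableOn (integrable_const M).integrableOn hM
      _ = M * μ.real A := by
          rw [setIntegral_const, unitVol_real_Ioi (by linarith) (by linarith), smul_eq_mul]
          ring
  have hm : Integrable (fun ω => max (Z ω - M) 0) μ :=
    (h.integrable.sub (integrable_const M)).pos_part
  have hz : ∫ ω, max (Z ω - M) 0 ∂μ = 0 := by
    refine le_antisymm ?_ (integral_nonneg fun ω => le_max_right _ _)
    have e : ∫ ω, max (Z ω - M) 0 ∂μ = ∫ ω in A, (Z ω - M) ∂μ := by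
      rw [← integral_indicator₀ hA]
      refine integral_congr_ae (ae_of_all _ fun ω => ?_)
      by_cases hω : M < Z ω
      · simp [indicator, A, hω, hω.le]
      · simp [indicator, A, hω, not_lt.1 hω]
    rw [e, integral_sub h.integrable.integrableOn (integrable_const M), setIntegral_const,
      smul_eq_mul]
    linarith
  rw [integral_eq_zero_iff_of_nonneg (f := fun ω => max (Z ω - M) 0)
    (fun ω => le_max_right _ _) hm] at hz
  refine memLp_top_of_bound h.integrable.aestronglyMeasurable M ?_
  filter_upwards [hz, h.ae_nonneg hσ] with ω hω hω0
  have h3 : Z ω - M ≤ 0 := (le_max_left _ _).trans_eq hω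
  rw [Real.norm_of_nonneg hω0]
  linarith

/-- The truncation `X` of a majorized variable has `r`-th moment at most that of `σ`: pair `Z` with
the bounded variable `X ^ (r - 1)` and apply Young's inequality to the resulting premium. -/
lemma Majorized.integral_truncation_rpow_le [IsProbabilityMeasure μ] (hσ : IsDistortion σ)
    (h : Majorized μ Z σ) {s r : ℝ} (hsr : s.HolderConjugate r)
    (hσr : Integrable (fun u => σ u ^ r) unitVol) (n : ℕ) :
    ∫ ω, (({ω | Z ω ∈ Icc 0 (n : ℝ)}.indicator Z) ω) ^ r ∂μ ≤ ∫ u, σ u ^ r ∂unitVol := by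
  set X : Ω → ℝ := {ω | Z ω ∈ Icc 0 (n : ℝ)}.indicator Z with hXdef
  have hX0 : ∀ ω, 0 ≤ X ω := fun ω => indicator_nonneg (fun _ hω => hω.1) ω
  have hXn : ∀ ω, X ω ≤ n := fun ω => indicator_le' (fun _ hω => hω.2) (fun _ _ => n.cast_nonneg) ω
  have hXm : AEMeasurable X μ := h.integrable.aemeasurable.indicator₀
    (h.integrable.aemeasurable.nullMeasurable measurableSet_Icc)
  set L : Ω → ℝ := fun ω => X ω ^ (r - 1) with hLdef
  have hr1 : 0 < r - 1 := sub_pos.2 hsr.symm.lt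
  have hL0 : ∀ ω, 0 ≤ L ω := fun ω => Real.rpow_nonneg (hX0 ω) _
  have hLm : AEMeasurable L μ := hXm.pow_const _
  have hLb : MemLp L ∞ μ := by
    refine memLp_top_of_bound hLm.aestronglyMeasurable ((n : ℝ) ^ (r - 1)) (ae_of_all _ fun ω => ?_)
    rw [Real.norm_of_nonneg (hL0 ω)]
    exact Real.rpow_le_rpow (hX0 ω) (hXn ω) hr1.le
  have hid := identDistrib_quantile hLm
  have hqb : MemLp (quantile μ L) ∞ unitVol := hid.memLp_iff.2 hLb
  have hLZ : ∀ ω, L ω * Z ω = X ω ^ r := fun ω => by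
    by_cases hω : Z ω ∈ Icc 0 (n : ℝ)
    · have e : X ω = Z ω := indicator_of_mem (s := {ω | Z ω ∈ Icc 0 (n : ℝ)}) hω Z
      rw [← e, hLdef, ← Real.rpow_add_one' (hX0 ω) (by linarith [hsr.symm.pos]), sub_add_cancel]
    · have e : X ω = 0 := indicator_of_notMem (s := {ω | Z ω ∈ Icc 0 (n : ℝ)}) hω Z
      simp only [hLdef, e, Real.zero_rpow hr1.ne', Real.zero_rpow hsr.symm.ne_zero, zero_mul]
  have hLs : ∀ ω, L ω ^ s = X ω ^ r := fun ω => by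
    rw [hLdef, ← Real.rpow_mul (hX0 ω), hsr.symm.sub_one_mul_conj]
  have hqs : IdentDistrib (fun u => quantile μ L u ^ s) (fun ω => L ω ^ s) unitVol μ :=
    hid.comp (u := fun x : ℝ => x ^ s) (by fun_prop)
  have hXr : Integrable (fun ω => L ω ^ s) μ := by
    refine Integrable.of_bound (hLm.pow_const _).aestronglyMeasurable ((n : ℝ) ^ r)
      (ae_of_all _ fun ω => ?_)
    rw [hLs, Real.norm_of_nonneg (Real.rpow_nonneg (hX0 ω) _)]
    exact Real.rpow_le_rpow (hX0 ω) (hXn ω) hsr.symm.nonneg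
  have hq0 : ∀ᵐ u ∂unitVol, 0 ≤ quantile μ L u :=
    hid.symm.ae_snd measurableSet_Ici (ae_of_all _ hL0)
  have hqσ : Integrable (fun u => quantile μ L u * σ u) unitVol :=
    hqb.integrable_mul (memLp_one_iff_integrable.2 hσ.integrable)
  have key : ∫ ω, X ω ^ r ∂μ ≤ (∫ ω, X ω ^ r ∂μ) / s + (∫ u, σ u ^ r ∂unitVol) / r := by
    calc ∫ ω, X ω ^ r ∂μ = ∫ ω, L ω * Z ω ∂μ := by simp only [hLZ]
      _ ≤ premium μ σ L := h.integral_mul_le_premium hσ hLm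
          (hLb.integrable_mul (memLp_one_iff_integrable.2 h.integrable)) hqσ
      _ ≤ ∫ u, (quantile μ L u ^ s / s + σ u ^ r / r) ∂unitVol := by
          rw [premium, intervalIntegral_zero_one]
          refine integral_mono_ae hqσ
            (((hqs.integrable_iff.2 hXr).div_const _).add (hσr.div_const _)) ?_
          filter_upwards [hq0, hσ.ae_nonneg] with u hu hu'
          exact Real.young_inequality_of_nonneg hu hu' hsr
      _ = _ := by
          rw [integral_add ((hqs.integrable_iff.2 hXr).div_const _) (hσr.div_const _),
            integral_div, integral_div, hqs.integral_eq]
          simp only [hLs]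
  have hs : s⁻¹ = 1 - r⁻¹ := by linarith [hsr.inv_add_inv_eq_one]
  rw [div_eq_mul_inv, div_eq_mul_inv, hs] at key
  have : (∫ ω, X ω ^ r ∂μ) * r⁻¹ ≤ (∫ u, σ u ^ r ∂unitVol) * r⁻¹ := by linarith
  exact le_of_mul_le_mul_right this (inv_pos.2 hsr.symm.pos)

lemma Majorized.memLp [IsProbabilityMeasure μ] {p q : ℝ≥0∞} (hpq : ENNReal.HolderConjugate p q)
    (hσ : IsDistortion σ) (hσq : MemLp σ q unitVol) (h : Majorized μ Z σ) : MemLp Z q μ := by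
  rcases eq_or_ne q ∞ with rfl | hqtop
  · exact h.memLp_top hσ hσq
  rcases eq_or_ne q 1 with rfl | hq1
  · exact memLp_one_iff_integrable.2 h.integrable
  have hptop : p ≠ ∞ := fun hp => hq1 ((ENNReal.HolderConjugate.eq_top_iff_eq_one p q).1 hp)
  have hq0 : q ≠ 0 := ENNReal.HolderConjugate.ne_zero q p
  have hp0 : p ≠ 0 := ENNReal.HolderConjugate.ne_zero p q
  have hsr : p.toReal.HolderConjugate q.toReal := by
    simpa using ENNReal.HolderTriple.toReal (p := p) (q := q) 1
      (ENNReal.toReal_pos hp0 hptop) (ENNReal.toReal_pos hq0 hqtop)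
  have hσe : (fun u => ‖σ u‖ ^ q.toReal) =ᵐ[unitVol] fun u => σ u ^ q.toReal := by
    filter_upwards [hσ.ae_nonneg] with u hu
    rw [Real.norm_of_nonneg hu]
  have hσr := (integrable_congr hσe).1 (hσq.integrable_norm_rpow hq0 hqtop)
  set X : ℕ → Ω → ℝ := fun n => {ω | Z ω ∈ Icc 0 (n : ℝ)}.indicator Z with hX
  have hX0 : ∀ n ω, 0 ≤ X n ω := fun n ω => indicator_nonneg (fun _ hω => hω.1) ω
  have hXm : ∀ n, AEStronglyMeasurable (X n) μ := fun n =>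
    (h.integrable.aemeasurable.indicator₀
      (h.integrable.aemeasurable.nullMeasurable measurableSet_Icc)).aestronglyMeasurable
  have hXq : ∀ n, MemLp (X n) q μ := fun n => by
    refine MemLp.of_bound (hXm n) n (ae_of_all _ fun ω => ?_)
    rw [Real.norm_of_nonneg (hX0 n ω)]
    exact indicator_le' (fun _ hω => hω.2) (fun _ _ => n.cast_nonneg) ω
  have hle : ∀ n, eLpNorm (X n) q μ ≤ eLpNorm σ q unitVol := fun n => by
    rw [(hXq n).eLpNorm_eq_integral_rpow_norm hq0 hqtop,
      hσq.eLpNorm_eq_integral_rpow_norm hq0 hqtop, integral_congr_ae hσe]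
    simp only [Real.norm_of_nonneg (hX0 n _)]
    refine ENNReal.ofReal_le_ofReal (Real.rpow_le_rpow
      (integral_nonneg fun ω => Real.rpow_nonneg (hX0 n ω) _)
      (h.integral_truncation_rpow_le hσ hsr hσr n) (inv_nonneg.2 ENNReal.toReal_nonneg))
  refine ⟨h.integrable.aestronglyMeasurable, ?_⟩
  -- the truncations are eventually equal to `Z`, so Fatou's lemma carries the bound to `Z`
  refine (Lp.eLpNorm_lim_le_liminf_eLpNorm hXm Z ?_).trans_lt (lt_of_le_of_lt ?_ hσq.2)
  · filter_upwards [h.ae_nonneg hσ] with ω hω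
    refine tendsto_const_nhds.congr' ?_
    obtain ⟨N, hN⟩ := exists_nat_ge (Z ω)
    filter_upwards [eventually_ge_atTop N] with n hn
    refine (indicator_of_mem (s := {ω | Z ω ∈ Icc 0 (n : ℝ)}) ?_ Z).symm
    exact ⟨hω, hN.trans (Nat.cast_le.2 hn)⟩
  · exact liminf_le_of_le (by isBoundedDefault) fun b hb => by
      obtain ⟨n, hn⟩ := hb.exists
      exact hn.trans (hle n)

/-! ### A maximizing density -/

/-- The supremum is attained at `Z = h ∘ L`, where `h` is the density, with respect to the law of
`L`, of the image under the quantile function of the measure with density `σ`. Where the law of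
`L` has an atom, `h` averages `σ` over the corresponding level set of the quantile function. -/
lemma exists_majorized_integral_mul_eq_premium [IsProbabilityMeasure μ] (hσ : IsDistortion σ)
    (hL : AEMeasurable L μ) :
    ∃ Z : Ω → ℝ, Majorized μ Z σ ∧ ∫ ω, L ω * Z ω ∂μ = premium μ σ L := by
  have hq : AEMeasurable (quantile μ L) unitVol := quantile_aemeasurable
  have hid := identDistrib_quantile hL
  set ρ := unitVol.withDensity fun u => ENNReal.ofReal (σ u) with hρ
  have hρac : ρ ≪ unitVol := withDensity_absolutelyContinuous _ _
  have hqρ : AEMeasurable (quantile μ L) ρ := hq.mono_ac hρac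
  have : IsProbabilityMeasure ρ :=
    isProbabilityMeasure_withDensity_ofReal hσ.integrable hσ.ae_nonneg hσ.integral_unitVol
  have := Measure.isProbabilityMeasure_map hL
  have := Measure.isProbabilityMeasure_map hqρ
  have hac : ρ.map (quantile μ L) ≪ μ.map L := by
    rw [← hid.map_eq]
    refine Measure.AbsolutelyContinuous.mk fun s hs h0 => ?_
    rw [Measure.map_apply_of_aemeasurable hq hs] at h0
    rw [Measure.map_apply_of_aemeasurable hqρ hs]
    exact hρac h0
  set h : ℝ → ℝ := fun x => ((ρ.map (quantile μ L)).rnDeriv (μ.map L) x).toReal with hdef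
  have hm : Measurable h := (Measure.measurable_rnDeriv _ _).ennreal_toReal
  have key : ∀ g : ℝ → ℝ, Measurable g →
      ∫ ω, g (L ω) * h (L ω) ∂μ = ∫ u, g (quantile μ L u) * σ u ∂unitVol := fun g hg => by
    rw [← integral_withDensity_ofReal hσ.integrable hσ.ae_nonneg,
      ← integral_map hqρ hg.aestronglyMeasurable,
      ← integral_map hL (f := fun x => g x * h x) (hg.mul hm).aestronglyMeasurable,
      ← integral_rnDeriv_smul hac]
    simp only [smul_eq_mul, mul_comm, hdef]
  have hint : Integrable (fun ω => h (L ω)) μ :=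
    (integrable_map_measure hm.aestronglyMeasurable hL).1 Measure.integrable_toReal_rnDeriv
  refine ⟨fun ω => h (L ω), majorized_of_integral_excess_le hσ hint ?_ fun c => ?_, ?_⟩
  · simpa [hσ.integral_unitVol] using key (fun _ => 1) measurable_const
  · set B : Set ℝ := {x | c < h x}
    have hB : MeasurableSet B := measurableSet_lt measurable_const hm
    have hg : Measurable (B.indicator fun _ => (1 : ℝ)) := measurable_const.indicator hB
    have hg01 : ∀ x, ‖B.indicator (fun _ => (1 : ℝ)) x‖ ≤ 1 := fun x => by
      by_cases hx : x ∈ B <;> simp [hx]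
    have hgq : Integrable (fun u => B.indicator (fun _ => (1 : ℝ)) (quantile μ L u)) unitVol :=
      Integrable.of_bound (hg.comp_aemeasurable hq).aestronglyMeasurable 1
        (ae_of_all _ fun u => hg01 _)
    have hgL : Integrable (fun ω => B.indicator (fun _ => (1 : ℝ)) (L ω)) μ :=
      Integrable.of_bound (hg.comp_aemeasurable hL).aestronglyMeasurable 1
        (ae_of_all _ fun u => hg01 _)
    have hgqσ : Integrable (fun u => B.indicator (fun _ => (1 : ℝ)) (quantile μ L u) * σ u)
        unitVol := hσ.integrable.bdd_mul hgq.aestronglyMeasurable (ae_of_all _ fun u => hg01 _)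
    have hgLh : Integrable (fun ω => B.indicator (fun _ => (1 : ℝ)) (L ω) * h (L ω)) μ :=
      hint.bdd_mul hgL.aestronglyMeasurable (ae_of_all _ fun u => hg01 _)
    calc ∫ ω, max (h (L ω) - c) 0 ∂μ
        = ∫ ω, (B.indicator (fun _ => (1 : ℝ)) (L ω) * h (L ω)
            - c * B.indicator (fun _ => (1 : ℝ)) (L ω)) ∂μ := by
          refine integral_congr_ae (ae_of_all _ fun ω => ?_)
          by_cases hω : c < h (L ω)
          · simp [indicator, B, hω, hω.le]
          · simp [indicator, B, hω, not_lt.1 hω]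
      _ = ∫ u, (B.indicator (fun _ => (1 : ℝ)) (quantile μ L u) * σ u
            - c * B.indicator (fun _ => (1 : ℝ)) (quantile μ L u)) ∂unitVol := by
          rw [integral_sub hgLh (hgL.const_mul c), integral_sub hgqσ (hgq.const_mul c), key _ hg,
            integral_const_mul, integral_const_mul]
          congr 2
          exact ((hid.comp hg).integral_eq).symm
      _ ≤ ∫ u, max (σ u - c) 0 ∂unitVol := by
          refine integral_mono (hgqσ.sub (hgq.const_mul c))
            (hσ.integrable.sub (integrable_const c)).pos_part fun u => ?_
          by_cases hu : quantile μ L u ∈ B <;> simp [hu]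
  · rw [premium, intervalIntegral_zero_one]
    exact key id measurable_id

/-! ### The dual representation and the conjugate -/

variable {p q : ℝ≥0∞}

lemma integrable_quantile_mul [IsProbabilityMeasure μ] (hpq : ENNReal.HolderConjugate p q)
    (hσq : MemLp σ q unitVol) (hL : MemLp L p μ) :
    Integrable (fun u => quantile μ L u * σ u) unitVol :=
  ((identDistrib_quantile hL.1.aemeasurable).memLp_iff.2 hL).integrable_mul hσq

lemma Majorized.integral_mul_le [IsProbabilityMeasure μ] (hpq : ENNReal.HolderConjugate p q)
    (hσ : IsDistortion σ) (hσq : MemLp σ q unitVol) (h : Majorized μ Z σ) (hL : MemLp L p μ) :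
    ∫ ω, L ω * Z ω ∂μ ≤ premium μ σ L :=
  h.integral_mul_le_premium hσ hL.1.aemeasurable (hL.integrable_mul (h.memLp hpq hσ hσq))
    (integrable_quantile_mul hpq hσq hL)

lemma isLUB_premium [IsProbabilityMeasure μ] (hpq : ENNReal.HolderConjugate p q)
    (hσ : IsDistortion σ) (hσq : MemLp σ q unitVol) (hL : MemLp L p μ) :
    IsLUB {r : ℝ | ∃ Z : Ω → ℝ, Majorized μ Z σ ∧ r = ∫ ω, L ω * Z ω ∂μ} (premium μ σ L) := by
  obtain ⟨Z, hZ, hZL⟩ := exists_majorized_integral_mul_eq_premium hσ hL.1.aemeasurable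
  refine IsGreatest.isLUB ⟨⟨Z, hZ, hZL.symm⟩, ?_⟩
  rintro r ⟨Y, hY, rfl⟩
  exact hY.integral_mul_le hpq hσ hσq hL

lemma premium_const_mul_le [IsProbabilityMeasure μ] (hpq : ENNReal.HolderConjugate p q)
    (hσ : IsDistortion σ) (hσq : MemLp σ q unitVol) (hL : MemLp L p μ) {t : ℝ} (ht : 0 ≤ t) :
    premium μ σ (fun ω => t * L ω) ≤ t * premium μ σ L := by
  obtain ⟨Z, hZ, hZL⟩ :=
    exists_majorized_integral_mul_eq_premium hσ (hL.const_mul t).1.aemeasurable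
  rw [← hZL]
  simp only [mul_assoc]
  rw [integral_const_mul]
  exact mul_le_mul_of_nonneg_left (hZ.integral_mul_le hpq hσ hσq hL) ht

lemma premium_const [IsProbabilityMeasure μ] (hσ : IsDistortion σ) (c : ℝ) :
    premium μ σ (fun _ : Ω => c) = c := by
  obtain ⟨Z, hZ, hZL⟩ :=
    exists_majorized_integral_mul_eq_premium (μ := μ) (L := fun _ => c) hσ aemeasurable_const
  rw [← hZL, integral_const_mul, hZ.integral_eq, hσ.integral_eq_one, mul_one]

lemma conjugate_eq_zero [IsProbabilityMeasure μ] (hpq : ENNReal.HolderConjugate p q)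
    (hσ : IsDistortion σ) (hσq : MemLp σ q unitVol) (h : Majorized μ Z σ) :
    conjugate μ p σ Z = 0 := by
  refine le_antisymm (iSup₂_le fun L hL => ?_) (le_iSup₂_of_le (fun _ => 0) (memLp_const 0) ?_)
  · rw [← EReal.coe_zero, EReal.coe_le_coe_iff, sub_nonpos]
    exact h.integral_mul_le hpq hσ hσq hL
  · simp [premium_const hσ]

/-- A single variable whose premium is exceeded makes the conjugate infinite, by scaling. -/
lemma conjugate_eq_top [IsProbabilityMeasure μ] (hpq : ENNReal.HolderConjugate p q)
    (hσ : IsDistortion σ) (hσq : MemLp σ q unitVol) (hL : MemLp L p μ)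
    (h : premium μ σ L < ∫ ω, L ω * Z ω ∂μ) : conjugate μ p σ Z = ⊤ := by
  rw [EReal.eq_top_iff_forall_lt]
  intro y
  set d := ∫ ω, L ω * Z ω ∂μ - premium μ σ L
  have hd : 0 < d := sub_pos.2 h
  have ht : 0 ≤ (|y| + 1) / d := by positivity
  refine lt_of_lt_of_le ?_
    (le_iSup₂_of_le (fun ω => (|y| + 1) / d * L ω) (hL.const_mul _) le_rfl)
  rw [EReal.coe_lt_coe_iff]
  simp only [mul_assoc]
  rw [integral_const_mul]
  have h1 := premium_const_mul_le hpq hσ hσq hL ht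
  have h2 : (|y| + 1) / d * d = |y| + 1 := div_mul_cancel₀ _ hd.ne'
  have h3 : (|y| + 1) / d * d =
    (|y| + 1) / d * ∫ ω, L ω * Z ω ∂μ - (|y| + 1) / d * premium μ σ L := mul_sub _ _ _
  linarith [le_abs_self y]

/-- A variable that is not majorized is detected either by a constant, when its mean is wrong, or
by the indicator of an event `Z > c`, when a tail inequality fails. -/
lemma exists_premium_lt_of_not_majorized [IsProbabilityMeasure μ]
    (hσ : IsDistortion σ) (hZ : Integrable Z μ) (h : ¬ Majorized μ Z σ) :
    ∃ L : Ω → ℝ, MemLp L p μ ∧ premium μ σ L < ∫ ω, L ω * Z ω ∂μ := by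
  rcases lt_trichotomy (∫ ω, Z ω ∂μ) 1 with h1 | h1 | h1
  · refine ⟨fun _ => -1, memLp_const _, ?_⟩
    rw [premium_const hσ, integral_const_mul]
    linarith
  · obtain ⟨c, hc⟩ : ∃ c : ℝ, ∫ u, max (σ u - c) 0 ∂unitVol < ∫ ω, max (Z ω - c) 0 ∂μ := by
      by_contra! hcon
      exact h (majorized_of_integral_excess_le hσ hZ h1 hcon)
    set A := {ω | c < Z ω} with hAdef
    have hA : NullMeasurableSet A μ := nullMeasurableSet_lt aemeasurable_const hZ.aemeasurable
    have hLm : AEMeasurable (A.indicator fun _ => (1 : ℝ)) μ := aemeasurable_const.indicator₀ hA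
    have hmul : ∀ Y : Ω → ℝ, ∫ ω, A.indicator (fun _ => (1 : ℝ)) ω * Y ω ∂μ = ∫ ω in A, Y ω ∂μ :=
      fun Y => by
        rw [← integral_indicator₀ hA]
        refine integral_congr_ae (ae_of_all _ fun ω => ?_)
        by_cases hω : ω ∈ A <;> simp [hω]
    have hZA : ∫ ω in A, Z ω ∂μ = ∫ ω, max (Z ω - c) 0 ∂μ + c * μ.real A := by
      have e : ∫ ω, max (Z ω - c) 0 ∂μ = ∫ ω in A, (Z ω - c) ∂μ := by
        rw [← integral_indicator₀ hA]
        refine integral_congr_ae (ae_of_all _ fun ω => ?_)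
        by_cases hω : c < Z ω
        · simp [indicator, A, hω, hω.le]
        · simp [indicator, A, hω, not_lt.1 hω]
      rw [e, integral_sub hZ.integrableOn (integrable_const c), setIntegral_const, smul_eq_mul]
      ring
    obtain ⟨Y, hY, hYL⟩ := exists_majorized_integral_mul_eq_premium hσ hLm
    refine ⟨A.indicator fun _ => 1, ?_, ?_⟩
    · refine MemLp.of_bound hLm.aestronglyMeasurable 1 (ae_of_all _ fun ω => ?_)
      by_cases hω : ω ∈ A <;> simp [hω]
    · rw [← hYL, hmul, hmul, hZA]
      have h0 : 0 ≤ μ.real A := measureReal_nonneg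
      have h1 : μ.real A ≤ 1 := measureReal_le_one
      have h2 := tail_integral_le hσ.integrable (a := 1 - μ.real A) (by linarith) (by linarith) c
      rw [sub_sub_cancel] at h2
      linarith [hY.setIntegral_le A]
  · refine ⟨fun _ => 1, memLp_const _, ?_⟩
    rw [premium_const hσ, integral_const_mul]
    linarith

end DistortedPremium

theorem mainTheorem1 {Ω : Type*} [MeasurableSpace Ω] (μ : Measure Ω) [IsProbabilityMeasure μ]
    (p q : ℝ≥0∞) (hpq : ENNReal.HolderConjugate p q)
    (σ : ℝ → ℝ) (hσ : DistortedPremium.IsDistortion σ)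
    (hσq : MemLp σ q (volume.restrict (Icc (0 : ℝ) 1))) :
    -- all expectations below are well defined
    (∀ Z : Ω → ℝ, DistortedPremium.Majorized μ Z σ → MemLp Z q μ) ∧
    (∀ L : Ω → ℝ, MemLp L p μ →
      -- the premium is finite, and it is the supremum
      IntervalIntegrable (fun u => DistortedPremium.quantile μ L u * σ u) volume 0 1 ∧
      IsLUB {r : ℝ | ∃ Z : Ω → ℝ, DistortedPremium.Majorized μ Z σ ∧
          r = ∫ ω, L ω * Z ω ∂μ}
        (DistortedPremium.premium μ σ L) ∧
      IsLUB {r : ℝ | ∃ Z : Ω → ℝ, Integrable Z μ ∧ ∫ ω, Z ω ∂μ = 1 ∧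
          (∀ α : ℝ, 0 ≤ α → α < 1 →
            ((1 - α : ℝ) : EReal) * DistortedPremium.CTE μ α Z
              ≤ ((∫ u in α..1, σ u : ℝ) : EReal)) ∧
          r = ∫ ω, L ω * Z ω ∂μ}
        (DistortedPremium.premium μ σ L)) ∧
    -- the convex conjugate is the indicator function of the stochastic dominance set
    (∀ Z : Ω → ℝ, MemLp Z q μ →
      DistortedPremium.conjugate μ p σ Z =
        DistortedPremium.convexIndicator {Y : Ω → ℝ | DistortedPremium.Majorized μ Y σ} Z) := by
  have hσ' : MemLp σ q DistortedPremium.unitVol :=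
    DistortedPremium.restrict_Icc_eq_unitVol ▸ hσq
  have forall_CTE : ∀ Z : Ω → ℝ,
      (∀ α : ℝ, 0 ≤ α → α < 1 → ((1 - α : ℝ) : EReal) * DistortedPremium.CTE μ α Z
        ≤ ((∫ u in α..1, σ u : ℝ) : EReal)) ↔
      ∀ α : ℝ, 0 ≤ α → α < 1 →
        ∫ u in α..1, DistortedPremium.quantile μ Z u ≤ ∫ u in α..1, σ u := fun Z =>
    forall_congr' fun _ => forall_congr' fun _ => forall_congr' fun hα =>
      DistortedPremium.mul_CTE_le_iff hα _
  refine ⟨fun Z hZ => hZ.memLp hpq hσ hσ', fun L hL => ?_, fun Z hZ => ?_⟩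
  · have hLUB := DistortedPremium.isLUB_premium hpq hσ hσ' hL
    refine ⟨?_, hLUB, ?_⟩
    · rw [intervalIntegrable_iff_integrableOn_Ioo_of_le zero_le_one]
      exact DistortedPremium.integrable_quantile_mul hpq hσ' hL
    · simpa only [DistortedPremium.majorized_iff, hσ.integral_eq_one, and_assoc,
        forall_CTE] using hLUB
  · by_cases h : DistortedPremium.Majorized μ Z σ
    · rw [DistortedPremium.conjugate_eq_zero hpq hσ hσ' h]
      exact (if_pos h).symm
    · have hZ1 : Integrable Z μ := hZ.integrable (ENNReal.HolderConjugate.one_le q p)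
      obtain ⟨L, hL, hlt⟩ := DistortedPremium.exists_premium_lt_of_not_majorized hσ hZ1 h
      rw [DistortedPremium.conjugate_eq_top hpq hσ hσ' hL hlt]
      exact (if_neg h).symm
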